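/- Let $(S,T)$ be a finite connected bordered triangulated surface (a simplicial triangulation of a compact connected surface $S$ with $\partial S\neq\emptyset$) with vertex set $V$. A planar circle packing is a collection of circles in the Euclidean plane whose union is connected and whose interiors (open discs) are pairwise disjoint; its contact graph has a vertex for each circle and an edge for each pair of tangent circles. A packing $P$ is of triangle type, modelled on $(S,T)$, if its circles can be labelled as $(P_v)_{v\in V}$ such that this labelling is an isomorphism between the contact graph of $P$ and the $1$-skeleton of $(S,T)$, and such that the centers realize the triangulated surface in the plane, i.e. the straight triangles spanned by the centers of $P_u,P_v,P_w$, for the triangles $uvw$ of $T$, have pairwise disjoint interiors. The circles $P_v$ with $v\in\partial S$ are the boundary circles. Let $P=(P_v)_{v\in V}$ and $P'=(P'_v)_{v\in V}$ be two triangle-type planar circle packings modelled on the same $(S,T)$. If $P_v$ and $P'_v$ have the same radius for every boundary vertex $v$, then $P_v$ and $P'_v$ have the same radius for every $v\in V$, and there is an isometry $g$ of the Euclidean plane with $g(P_v)=P'_v$ for every $v\in V$. -/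

import Mathlib

/-- The Euclidean plane. -/
abbrev Plane : Type := EuclideanSpace ℝ (Fin 2)

/-- The 1-skeleton of the 2-dimensional simplicial complex whose 2-faces are the members of `T`:
two distinct vertices are joined iff they lie in a common triangle. -/
def triangleSkeleton {V : Type*} (T : Set (Finset V)) : SimpleGraph V where
  Adj u v := u ≠ v ∧ ∃ t ∈ T, u ∈ t ∧ v ∈ t
  symm := ⟨fun _ _ ⟨hne, t, ht, hu, hv⟩ => ⟨hne.symm, t, ht, hv, hu⟩⟩
  loopless := ⟨fun _ h => h.1 rfl⟩

/-- The link of the vertex `v`: its vertices are the neighbours of `v`, and two distinct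
neighbours `a`, `b` are joined iff `v, a, b` span a triangle of `T`. -/
def triangleLink {V : Type*} (T : Set (Finset V)) (v : V) :
    SimpleGraph ((triangleSkeleton T).neighborSet v) where
  Adj a b := a ≠ b ∧ ∃ t ∈ T, v ∈ t ∧ (a : V) ∈ t ∧ (b : V) ∈ t
  symm := ⟨fun _ _ ⟨hne, t, ht, hv, ha, hb⟩ => ⟨hne.symm, t, ht, hv, hb, ha⟩⟩
  loopless := ⟨fun _ h => h.1 rfl⟩

/-- The graph `G` is a cycle (with at least three vertices). -/
def IsCycleGraph {W : Type*} (G : SimpleGraph W) : Prop :=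
  ∃ n : ℕ, Nonempty (G ≃g SimpleGraph.cycleGraph (n + 3))

/-- The graph `G` is a path (with at least one edge). -/
def IsPathGraph {W : Type*} (G : SimpleGraph W) : Prop :=
  ∃ n : ℕ, Nonempty (G ≃g SimpleGraph.pathGraph (n + 2))

/-- A connected triangulated surface with non-empty boundary, with vertex set `V`, given by its
set of triangles.  The condition on links says that the complex is a surface with boundary: the
link of an interior vertex is a cycle and the link of a boundary vertex is a path.  In particular
every vertex lies in a triangle and every edge lies in one or two triangles. -/
structure BorderedTriangulatedSurface (V : Type*) where
  triangles : Set (Finset V)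
  card_triangle : ∀ t ∈ triangles, t.card = 3
  connected : (triangleSkeleton triangles).Connected
  link_cycle_or_path :
    ∀ v, IsCycleGraph (triangleLink triangles v) ∨ IsPathGraph (triangleLink triangles v)
  bordered : ∃ v, IsPathGraph (triangleLink triangles v)

namespace BorderedTriangulatedSurface

variable {V : Type*} (S : BorderedTriangulatedSurface V)

/-- The 1-skeleton of the triangulated surface. -/
def skeleton : SimpleGraph V := triangleSkeleton S.triangles

/-- `v` lies on the boundary of the surface. -/
def IsBoundaryVertex (v : V) : Prop := IsPathGraph (triangleLink S.triangles v)

end BorderedTriangulatedSurface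

/-- A planar circle packing: a connected collection of circles in the Euclidean plane whose
interiors (the open discs they bound) are pairwise disjoint. -/
structure PlanarCirclePacking (ι : Type*) where
  center : ι → Plane
  radius : ι → ℝ
  radius_pos : ∀ i, 0 < radius i
  disjoint_interiors :
    Pairwise fun i j => Disjoint (Metric.ball (center i) (radius i))
      (Metric.ball (center j) (radius j))
  connected : IsConnected (⋃ i, Metric.sphere (center i) (radius i))

namespace PlanarCirclePacking

variable {ι : Type*} (P : PlanarCirclePacking ι)

/-- The `i`-th circle of the packing. -/
def circle (i : ι) : Set Plane := Metric.sphere (P.center i) (P.radius i)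

/-- The contact graph: one vertex for each circle and an edge for each pair of (distinct)
tangent circles.  As the interiors are disjoint, tangency means that the distance of the centers
is the sum of the radii. -/
def contactGraph : SimpleGraph ι where
  Adj i j := i ≠ j ∧ dist (P.center i) (P.center j) = P.radius i + P.radius j
  symm := ⟨fun i j ⟨hne, h⟩ => ⟨hne.symm, by rw [dist_comm, h, add_comm]⟩⟩
  loopless := ⟨fun _ h => h.1 rfl⟩

/-- A triangle-type structure on the packing `P`, modelled on the bordered triangulated surface
`S`: an isomorphism of the contact graph of `P` with the 1-skeleton of `S`, such that the centers
of the circles and the segments between centers of tangent circles triangulate a surface in the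
plane, i.e. the straight triangles spanned by the centers that correspond to the triangles of `S`
do not overlap. -/
structure TriangleType {V : Type*} (S : BorderedTriangulatedSurface V) where
  iso : P.contactGraph ≃g S.skeleton
  nonoverlapping :
    S.triangles.Pairwise fun s t =>
      Disjoint (interior (convexHull ℝ ((fun v => P.center (iso.symm v)) '' (s : Set V))))
        (interior (convexHull ℝ ((fun v => P.center (iso.symm v)) '' (t : Set V))))

end PlanarCirclePacking

/-! The radii are determined by a maximum principle, and the centers are then determined by laying
out triangles one at a time.

Radii: around an interior vertex the triangles form a closed fan with non-overlapping interiors, so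
their angles at that vertex sum to exactly 2π (`sum_angle_fan`). In a triangle of three mutually
tangent circles of radii x, y, z, the angle at x depends only on y/(x+y) and z/(x+z), and increases
with both. Let l be the maximal ratio of the radii of the two packings. If it is attained at an
interior vertex, every angle there in one packing is at most the corresponding angle in the other;
both sums being 2π, all are equal, so every neighbour also has ratio l (`radius_eq_mul_of_adj`). If
l > 1, the ratio l spreads through the connected surface to a boundary vertex, where the ratio is 1.
Exchanging the packings gives equality (`radius_le`).

Centers: with equal radii, an isometry, possibly reversing orientation, carries one triangle to its
counterpart. Across a common edge, the next center is known up to reflection in that edge, and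
non-overlap puts it on the side away from the previous triangle. Connectedness of the links and of
the 1-skeleton carries the agreement to every vertex (`eq_of_eq_on_triangle`). -/

open Complex

/-! ### Triangles and cones in the complex plane -/

/-- The signed area of the parallelogram spanned by two complex numbers. -/
def cross (p q : ℂ) : ℝ := p.re * q.im - p.im * q.re

/-- The point `w` lies in the open convex cone spanned by `p` and `q`. -/
def InOpenCone (p q w : ℂ) : Prop := 0 < cross w q * cross p q ∧ 0 < cross p w * cross p q

theorem continuous_cross {f g : ℂ → ℂ} (hf : Continuous f) (hg : Continuous g) :
    Continuous fun z => cross (f z) (g z) := by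
  unfold cross
  fun_prop

/-- The hypotheses say that the barycentric coordinates of z at p, q and o are positive. They are
multiplied by the signed area D or its square to clear denominators without fixing an orientation.
Strict inequalities cut out an open set, which therefore lies in the interior of the hull. -/
theorem mem_interior_convexHull_triangle {o p q z : ℂ}
    (h₁ : 0 < cross (z - o) (q - o) * cross (p - o) (q - o))
    (h₂ : 0 < cross (p - o) (z - o) * cross (p - o) (q - o))
    (h₃ : (cross (z - o) (q - o) + cross (p - o) (z - o)) * cross (p - o) (q - o)
      < cross (p - o) (q - o) ^ 2) :
    z ∈ interior (convexHull ℝ {o, p, q}) := by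
  set D := cross (p - o) (q - o) with hD
  let U : Set ℂ := {z | 0 < cross (z - o) (q - o) * D} ∩ {z | 0 < cross (p - o) (z - o) * D} ∩
    {z | (cross (z - o) (q - o) + cross (p - o) (z - o)) * D < D ^ 2}
  have c₁ : Continuous fun z => cross (z - o) (q - o) :=
    continuous_cross (by fun_prop) (by fun_prop)
  have c₂ : Continuous fun z => cross (p - o) (z - o) :=
    continuous_cross (by fun_prop) (by fun_prop)
  have hU : IsOpen U :=
    ((isOpen_lt continuous_const (c₁.mul continuous_const)).inter
      (isOpen_lt continuous_const (c₂.mul continuous_const))).inter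
      (isOpen_lt ((c₁.add c₂).mul continuous_const) continuous_const)
  refine mem_interior.2 ⟨U, ?_, hU, ⟨⟨h₁, h₂⟩, h₃⟩⟩
  rintro x ⟨⟨hx₁, hx₂⟩, hx₃⟩
  simp only [Set.mem_ofPred_eq] at hx₁ hx₂ hx₃
  have hD0 : D ≠ 0 := by rintro h; simp [h] at hx₁
  have hD2 : 0 < D ^ 2 := by positivity
  set s := cross (x - o) (q - o) * D / D ^ 2 with hs
  set t := cross (p - o) (x - o) * D / D ^ 2 with ht
  have hs0 : 0 < s := div_pos hx₁ hD2
  have ht0 : 0 < t := div_pos hx₂ hD2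
  have hst : s + t < 1 := by
    rw [hs, ht, ← add_div, div_lt_one hD2]; linarith
  have key : x = (1 - s - t) • o + s • p + t • q := by
    have hs' : s * D = cross (x - o) (q - o) := by rw [hs]; field_simp
    have ht' : t * D = cross (p - o) (x - o) := by rw [ht]; field_simp
    have e₁ : D * (x.re - ((1 - s - t) * o.re + s * p.re + t * q.re)) = 0 := by
      have : D * (x.re - ((1 - s - t) * o.re + s * p.re + t * q.re)) =
        D * (x.re - o.re) - s * D * (p.re - o.re) - t * D * (q.re - o.re) := by ring
      rw [this, hs', ht', hD]; simp only [cross, sub_re, sub_im]; ring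
    have e₂ : D * (x.im - ((1 - s - t) * o.im + s * p.im + t * q.im)) = 0 := by
      have : D * (x.im - ((1 - s - t) * o.im + s * p.im + t * q.im)) =
        D * (x.im - o.im) - s * D * (p.im - o.im) - t * D * (q.im - o.im) := by ring
      rw [this, hs', ht', hD]; simp only [cross, sub_re, sub_im]; ring
    have e₁' := (mul_eq_zero.1 e₁).resolve_left hD0
    have e₂' := (mul_eq_zero.1 e₂).resolve_left hD0
    apply Complex.ext <;> simp <;> linarith
  have hmem : ∀ y ∈ ({o, p, q} : Set ℂ), y ∈ convexHull ℝ ({o, p, q} : Set ℂ) :=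
    fun y hy => subset_convexHull ℝ _ hy
  have hc := convex_convexHull ℝ ({o, p, q} : Set ℂ)
  have hst0 : s + t ≠ 0 := by positivity
  -- The three-point combination is nested: first a point of the side pq, then a point of the
  -- segment from o to it.
  have hy := hc (hmem p (by simp)) (hmem q (by simp)) (a := s / (s + t)) (b := t / (s + t))
    (by positivity) (by positivity) (by field_simp)
  have hz := hc (hmem o (by simp)) hy (a := 1 - s - t) (b := s + t) (by linarith) (by linarith)
    (by ring)
  rw [smul_add, smul_smul, smul_smul, mul_div_cancel₀ _ hst0, mul_div_cancel₀ _ hst0,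
    ← add_assoc] at hz
  rwa [key]

theorem exists_smul_mem_interior_triangle {o p q w : ℂ} (h : InOpenCone (p - o) (q - o) w) :
    ∃ δ : ℝ, 0 < δ ∧ ∀ ε : ℝ, 0 < ε → ε < δ → o + (ε : ℂ) * w ∈ interior (convexHull ℝ {o, p, q}) := by
  obtain ⟨h₁, h₂⟩ := h
  set D := cross (p - o) (q - o) with hD
  have hD0 : D ≠ 0 := by rintro h; simp [h] at h₁
  have hD2 : 0 < D ^ 2 := by positivity
  have hs : 0 < cross w (q - o) * D + cross (p - o) w * D := add_pos h₁ h₂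
  refine ⟨D ^ 2 / (cross w (q - o) * D + cross (p - o) w * D), div_pos hD2 hs, fun ε hε hlt => ?_⟩
  have e₁ : cross (o + ε * w - o) (q - o) = ε * cross w (q - o) := by
    simp [cross]; ring
  have e₂ : cross (p - o) (o + ε * w - o) = ε * cross (p - o) w := by
    simp [cross]; ring
  rw [lt_div_iff₀ hs] at hlt
  apply mem_interior_convexHull_triangle
  · rw [e₁, ← hD, mul_assoc]; exact mul_pos hε h₁
  · rw [e₂, ← hD, mul_assoc]; exact mul_pos hε h₂
  · rw [e₁, e₂, ← hD]; linarith

/-- Near its apex a triangle fills its cone, so a direction common to both cones gives a point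
common to both interiors. -/
theorem not_inOpenCone_of_disjoint {o p q p' q' : ℂ}
    (h : Disjoint (interior (convexHull ℝ {o, p, q})) (interior (convexHull ℝ {o, p', q'})))
    (w : ℂ) (h₁ : InOpenCone (p - o) (q - o) w) (h₂ : InOpenCone (p' - o) (q' - o) w) : False := by
  obtain ⟨δ, hδ, H⟩ := exists_smul_mem_interior_triangle h₁
  obtain ⟨δ', hδ', H'⟩ := exists_smul_mem_interior_triangle h₂
  obtain ⟨ε, hε, hlt⟩ := exists_between (lt_min hδ hδ')
  exact Set.disjoint_left.1 h (H ε hε (hlt.trans_le (min_le_left _ _)))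
    (H' ε hε (hlt.trans_le (min_le_right _ _)))

/-- If q and q' were on the same side of the line through p, the direction p + εq, a slight turn of
p towards them, would lie in both cones. -/
theorem cross_mul_cross_neg {p q q' : ℂ} (h : ∀ w, InOpenCone p q w → InOpenCone p q' w → False)
    (hq : cross p q ≠ 0) (hq' : cross p q' ≠ 0) : cross p q * cross p q' < 0 := by
  by_contra! hn
  have hpos : 0 < cross p q * cross p q' := lt_of_le_of_ne hn (mul_ne_zero hq hq').symm
  set A := |cross q q' * cross p q'| + 1 with hA
  have hA0 : 0 < A := by positivity
  have hB : 0 < cross p q' ^ 2 := by positivity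
  have hC : 0 < cross p q ^ 2 := by positivity
  -- Small enough that the perturbation ε * `cross q q'` cannot change the sign of `cross p q'`.
  set ε := cross p q' ^ 2 / A with hε
  have hε0 : 0 < ε := by positivity
  have e₁ : cross (p + ε * q) q = cross p q := by simp [cross]; ring
  have e₂ : cross p (p + ε * q) = ε * cross p q := by simp [cross]; ring
  have e₃ : cross (p + ε * q) q' = cross p q' + ε * cross q q' := by simp [cross]; ring
  refine h (p + ε * q) ⟨?_, ?_⟩ ⟨?_, ?_⟩
  · rw [e₁]; nlinarith
  · rw [e₂]; nlinarith [mul_pos hε0 hC]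
  · rw [e₃]
    have hlt : -A < cross q q' * cross p q' := by
      have := neg_abs_le (cross q q' * cross p q'); linarith
    have : ε * A = cross p q' ^ 2 := by rw [hε]; field_simp
    nlinarith [mul_lt_mul_of_pos_left hlt hε0]
  · rw [e₂]; nlinarith [mul_pos hε0 hpos]

/-- Rays `p 0, …, p n = p 0` that turn counterclockwise and span non-overlapping cones turn around
exactly once. -/
theorem sum_arg_div_eq_two_pi {n : ℕ} (hn : 0 < n) {p : ℕ → ℂ} (hp : p n = p 0)
    (hpos : ∀ i < n, 0 < cross (p i) (p (i + 1)))
    (hdis : ∀ i < n, ∀ j < n, i ≠ j → ∀ w, InOpenCone (p i) (p (i + 1)) w →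
      InOpenCone (p j) (p (j + 1)) w → False) :
    ∑ i ∈ Finset.range n, arg (p (i + 1) / p i) = 2 * Real.pi := by
  have hne : ∀ i < n, p i ≠ 0 := fun i hi h => by
    have := hpos i hi; simp [h, cross] at this
  have hne' : ∀ i ≤ n, p i ≠ 0 := fun i hi => by
    rcases hi.lt_or_eq with h | rfl
    · exact hne i h
    · rw [hp]; exact hne 0 hn
  set θ : ℕ → ℝ := fun i => arg (p (i + 1) / p i) with hθ
  set A : ℕ → ℝ := fun j => ∑ i ∈ Finset.range j, θ i with hAdef
  have hAs : ∀ j, A (j + 1) = A j + θ j := fun j => Finset.sum_range_succ _ _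
  have hA0 : A 0 = 0 := by simp [hAdef]
  have hθpos : ∀ i < n, 0 < θ i ∧ θ i < Real.pi := by
    intro i hi
    have him : 0 < (p (i + 1) / p i).im := by
      have : (p (i + 1) / p i).im = cross (p i) (p (i + 1)) / normSq (p i) := by
        rw [div_im, cross]; ring
      rw [this]; exact div_pos (hpos i hi) (normSq_pos.2 (hne i hi))
    refine ⟨?_, ?_⟩
    · rcases (arg_nonneg_iff.2 him.le).lt_or_eq with h | h
      · exact h
      · exact absurd (arg_eq_zero_iff.1 h.symm).2 him.ne'
    · exact arg_lt_pi_iff.2 (Or.inr him.ne')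
  set u : ℂ := p 0 / ‖p 0‖ with hu
  have hu1 : normSq u = 1 := by
    have h0 := hne 0 hn
    rw [normSq_eq_norm_sq, hu, norm_div, norm_real, norm_norm, div_self (norm_ne_zero_iff.2 h0)]
    norm_num
  -- `A j` is a continuous lift of the argument of `p j`, measured from `p 0`. Unlike `arg` it
  -- records how often the rays have turned.
  have hpol : ∀ j ≤ n, p j = ‖p j‖ * (u * exp (A j * I)) := by
    intro j
    induction j with
    | zero =>
      intro _
      have : (‖p 0‖ : ℂ) ≠ 0 := by simpa using hne 0 hn
      rw [hA0, hu]; field_simp; simp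
    | succ j ih =>
      intro hj
      have h1 := ih (by omega)
      have hj0 := hne j (by omega)
      have hj0' : (‖p j‖ : ℂ) ≠ 0 := by simpa using hj0
      have h2 := norm_mul_exp_arg_mul_I (p (j + 1) / p j)
      have h3 : p (j + 1) = p j * (‖p (j + 1) / p j‖ * exp (θ j * I)) := by
        rw [h2]; field_simp
      rw [hAs, ofReal_add, add_mul, exp_add]
      rw [norm_div, ofReal_div] at h3
      calc p (j + 1) = p j * (‖p (j + 1)‖ / ‖p j‖ * exp (θ j * I)) := h3
        _ = ‖p j‖ * (u * exp (A j * I)) * (‖p (j + 1)‖ / ‖p j‖ * exp (θ j * I)) := by rw [← h1]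
        _ = _ := by field_simp
  have hcr : ∀ a b : ℝ, ∀ x y : ℝ, cross (x * (u * exp (a * I))) (y * (u * exp (b * I))) =
      x * y * Real.sin (b - a) := by
    intro a b x y
    rw [Real.sin_sub]
    have : cross (x * (u * exp (a * I))) (y * (u * exp (b * I))) = x * y * normSq u *
        (Real.sin b * Real.cos a - Real.cos b * Real.sin a) := by
      simp only [cross, normSq_apply, mul_re, mul_im, ofReal_re, ofReal_im, exp_ofReal_mul_I_re,
        exp_ofReal_mul_I_im]
      ring
    rw [this, hu1, mul_one]
  have hcone : ∀ j < n, ∀ φ : ℝ, A j < φ → φ < A (j + 1) →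
      InOpenCone (p j) (p (j + 1)) (u * exp (φ * I)) := by
    intro j hj φ h₁ h₂
    have hn1 : 0 < ‖p j‖ := norm_pos_iff.2 (hne j hj)
    have hn2 : 0 < ‖p (j + 1)‖ := norm_pos_iff.2 (hne' (j + 1) hj)
    have hb := hθpos j hj
    have hs := hAs j
    have k₁ := hcr φ (A (j + 1)) 1 ‖p (j + 1)‖
    have k₂ := hcr (A j) φ ‖p j‖ 1
    rw [← hpol (j + 1) hj, ofReal_one, one_mul, one_mul] at k₁
    rw [← hpol j hj.le, ofReal_one, one_mul, mul_one] at k₂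
    refine ⟨mul_pos ?_ (hpos j hj), mul_pos ?_ (hpos j hj)⟩
    · rw [k₁]
      exact mul_pos hn2 (Real.sin_pos_of_pos_of_lt_pi (by linarith) (by linarith))
    · rw [k₂]
      exact mul_pos hn1 (Real.sin_pos_of_pos_of_lt_pi (by linarith) (by linarith))
  have hAn : 0 < A n := Finset.sum_pos (fun i hi => (hθpos i (Finset.mem_range.1 hi)).1)
    ⟨0, Finset.mem_range.2 hn⟩
  have hle : A n ≤ 2 * Real.pi := by
    by_contra! hgt
    have hex : ∃ j, 2 * Real.pi < A j := ⟨n, hgt⟩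
    classical
    -- The first ray past a full turn closes a cone j containing the direction 2π + ε for small ε.
    -- This is the direction ε, already in cone 0, and j is not 0 because a single step turns by
    -- less than π.
    set k := Nat.find hex with hk
    have hk1 : 2 * Real.pi < A k := Nat.find_spec hex
    have hkn : k ≤ n := Nat.find_min' hex hgt
    have hk0 : k ≠ 0 := by
      intro h; rw [h, hA0] at hk1; linarith [Real.pi_pos]
    obtain ⟨j, hj⟩ := Nat.exists_eq_succ_of_ne_zero hk0
    have hj1 : A j ≤ 2 * Real.pi := not_lt.1 (Nat.find_min hex (by omega))
    rw [hj] at hk1 hkn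
    have hjn : j < n := hkn
    have hj0 : j ≠ 0 := by
      rintro rfl
      have := hAs 0
      have := (hθpos 0 hn).2
      simp only [Nat.succ_eq_add_one] at hk1
      linarith [Real.pi_pos]
    obtain ⟨ε, hε, hlt⟩ := exists_between (lt_min (hθpos 0 hn).1 (sub_pos.2 hk1))
    have hε1 := hlt.trans_le (min_le_left _ _)
    have hε2 := hlt.trans_le (min_le_right _ _)
    have h₁ := hcone 0 hn ε (by rw [hA0]; exact hε) (by rw [hAs, hA0]; linarith)
    have h₂ := hcone j hjn (2 * Real.pi + ε) (by linarith) (by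
      simp only [Nat.succ_eq_add_one] at hε2; linarith)
    have : exp (((2 * Real.pi + ε : ℝ) : ℂ) * I) = exp (ε * I) := by
      push_cast
      rw [add_mul, exp_add, exp_two_pi_mul_I, one_mul]
    rw [this] at h₂
    exact hdis 0 hn j hjn hj0.symm _ h₁ h₂
  -- The rays close up, so the total is an integer multiple of 2π; being in (0, 2π], it is 2π.
  have hexp : exp (A n * I) = 1 := by
    have h := hpol n le_rfl
    have h0 := hpol 0 n.zero_le
    rw [hp, h0] at h
    have hn0 : (‖p 0‖ : ℂ) ≠ 0 := by simpa using hne 0 hn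
    have hu0 : u ≠ 0 := by rintro h; simp [h] at hu1
    rw [← h0] at h
    have h' : p 0 = p 0 * exp (A n * I) := by
      conv_lhs => rw [h]
      conv_rhs => rw [h0, hA0]
      simp; ring
    exact (mul_eq_left₀ (hne 0 hn)).1 h'.symm
  obtain ⟨m, hm⟩ := exp_eq_one_iff.1 hexp
  have hm' : A n = m * (2 * Real.pi) := by
    have : (A n : ℂ) = ((m * (2 * Real.pi) : ℝ) : ℂ) := by
      apply mul_right_cancel₀ I_ne_zero
      rw [hm]; push_cast; ring
    exact_mod_cast this
  have hpi := Real.pi_pos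
  have hm1 : (0 : ℝ) < m := by
    by_contra! h
    nlinarith
  have hm2 : (m : ℝ) < 2 := by
    by_contra! h
    nlinarith
  have : m = 1 := by
    have h1 : 0 < m := by exact_mod_cast hm1
    have h2 : m < 2 := by exact_mod_cast hm2
    omega
  change A n = _
  rw [hm', this]; simp

theorem cross_conj (p q : ℂ) : cross (starRingEnd ℂ p) (starRingEnd ℂ q) = -cross p q := by
  simp [cross]; ring

theorem inOpenCone_conj {p q w : ℂ} :
    InOpenCone (starRingEnd ℂ p) (starRingEnd ℂ q) w ↔ InOpenCone p q (starRingEnd ℂ w) := by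
  have h := cross_conj w (starRingEnd ℂ q)
  have h' := cross_conj (starRingEnd ℂ p) w
  rw [conj_conj] at h h'
  simp [InOpenCone, cross_conj, h, h']

/-- Consecutive turns have the same sign, so all turns do. The clockwise case becomes the
counterclockwise one under complex conjugation. -/
theorem sum_angle_eq_two_pi {n : ℕ} (hn : 0 < n) {p : ℕ → ℂ} (hp : p n = p 0)
    (hne : ∀ i < n, cross (p i) (p (i + 1)) ≠ 0)
    (hopp : ∀ i, i + 1 < n → 0 < cross (p i) (p (i + 1)) * cross (p (i + 1)) (p (i + 2)))
    (hdis : ∀ i < n, ∀ j < n, i ≠ j → ∀ w, InOpenCone (p i) (p (i + 1)) w →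
      InOpenCone (p j) (p (j + 1)) w → False) :
    ∑ i ∈ Finset.range n, InnerProductGeometry.angle (p i) (p (i + 1)) = 2 * Real.pi := by
  have main : ∀ p : ℕ → ℂ, p n = p 0 →
      (∀ i < n, cross (p i) (p (i + 1)) ≠ 0) →
      (∀ i, i + 1 < n → 0 < cross (p i) (p (i + 1)) * cross (p (i + 1)) (p (i + 2))) →
      (∀ i < n, ∀ j < n, i ≠ j → ∀ w, InOpenCone (p i) (p (i + 1)) w →
        InOpenCone (p j) (p (j + 1)) w → False) → 0 < cross (p 0) (p 1) →
      ∑ i ∈ Finset.range n, InnerProductGeometry.angle (p i) (p (i + 1)) = 2 * Real.pi := by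
    intro p hp hne hopp hdis h0
    have hpos : ∀ i < n, 0 < cross (p i) (p (i + 1)) := by
      intro i
      induction i with
      | zero => exact fun _ => h0
      | succ i ih =>
        intro hi
        exact (pos_iff_pos_of_mul_pos (hopp i hi)).1 (ih (by omega))
    rw [← sum_arg_div_eq_two_pi hn hp hpos hdis]
    refine Finset.sum_congr rfl fun i hi => ?_
    have hi := hpos i (Finset.mem_range.1 hi)
    have hi0 : p i ≠ 0 := by rintro h; simp [h, cross] at hi
    have hi1 : p (i + 1) ≠ 0 := by rintro h; simp [h, cross] at hi
    rw [InnerProductGeometry.angle_comm, angle_eq_abs_arg hi1 hi0, abs_of_nonneg]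
    rw [arg_nonneg_iff, div_im]
    have : (p (i + 1)).im * (p i).re / normSq (p i) - (p (i + 1)).re * (p i).im / normSq (p i) =
        cross (p i) (p (i + 1)) / normSq (p i) := by rw [cross]; ring
    rw [this]
    exact div_nonneg hi.le (normSq_nonneg _)
  rcases (hne 0 hn).lt_or_gt with h | h
  · have := main (fun i => starRingEnd ℂ (p i)) (by simp [hp])
      (fun i hi => by simpa [cross_conj] using hne i hi)
      (fun i hi => by simpa [cross_conj] using hopp i hi)
      (fun i hi j hj hij w h₁ h₂ => hdis i hi j hj hij _ (inOpenCone_conj.1 h₁)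
        (inOpenCone_conj.1 h₂)) (by simpa [cross_conj] using h)
    rw [← this]
    refine Finset.sum_congr rfl fun i _ => ?_
    exact (LinearIsometry.angle_map conjLIE.toLinearIsometry (p i) (p (i + 1))).symm
  · exact main p hp hne hopp hdis h

/-! ### Triangles with prescribed side lengths -/

theorem cross_sq_add_inner_sq (p q : ℂ) :
    cross p q ^ 2 + (inner ℝ p q) ^ 2 = ‖p‖ ^ 2 * ‖q‖ ^ 2 := by
  rw [Complex.sq_norm, Complex.sq_norm, Complex.inner]
  simp [cross, normSq_apply]; ring

theorem inner_of_dist {p q : ℂ} {x y z : ℝ} (hp : ‖p‖ = x + y) (hq : ‖q‖ = x + z)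
    (hpq : ‖p - q‖ = y + z) : inner ℝ p q = (x + y) * (x + z) - 2 * (y * z) := by
  have := norm_sub_sq_real p q
  rw [hp, hq, hpq] at this
  linarith [this]

/-- Heron's formula: for sides x+y, x+z, y+z the squared cross product is 4xyz(x+y+z). -/
theorem cross_ne_zero_of_dist {p q : ℂ} {x y z : ℝ} (hx : 0 < x) (hy : 0 < y) (hz : 0 < z)
    (hp : ‖p‖ = x + y) (hq : ‖q‖ = x + z) (hpq : ‖p - q‖ = y + z) : cross p q ≠ 0 := by
  have hi := inner_of_dist hp hq hpq
  have h := cross_sq_add_inner_sq p q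
  rw [hi, hp, hq] at h
  have h2 : cross p q ^ 2 = 4 * (x * y * z * (x + y + z)) := by linarith
  intro h0
  rw [h0] at h2
  have : 0 < x * y * z * (x + y + z) := by positivity
  linarith

/-- The law of cosines, arranged so that y and z enter only through ratios that are increasing in
them and invariant under scaling of all radii. -/
theorem angle_of_dist {p q : ℂ} {x y z : ℝ} (hx : 0 < x) (hy : 0 < y) (hz : 0 < z)
    (hp : ‖p‖ = x + y) (hq : ‖q‖ = x + z) (hpq : ‖p - q‖ = y + z) :
    InnerProductGeometry.angle p q = Real.arccos (1 - 2 * (y / (x + y) * (z / (x + z)))) := by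
  rw [InnerProductGeometry.angle, inner_of_dist hp hq hpq, hp, hq]
  congr 1
  field_simp

/-- Angles of triangles of three mutually tangent circles, compared. -/
theorem arccos_le_of_ratio_le {a b a' b' : ℝ} (ha' : 0 < a') (hb' : 0 < b') (ha : a' ≤ a)
    (hb : b' ≤ b) (ha1 : a < 1) (hb1 : b < 1) :
    Real.arccos (1 - 2 * (a' * b')) ≤ Real.arccos (1 - 2 * (a * b)) ∧
    (Real.arccos (1 - 2 * (a' * b')) = Real.arccos (1 - 2 * (a * b)) → a' = a) := by
  have h1 : a' * b' ≤ a * b := mul_le_mul ha hb hb'.le (ha'.le.trans ha)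
  have h2 : a * b < 1 := mul_lt_one_of_nonneg_of_lt_one_left (ha'.le.trans ha) ha1 hb1.le
  have h3 : 0 < a' * b' := mul_pos ha' hb'
  refine ⟨Real.arccos_le_arccos (by linarith), fun h => ?_⟩
  have := Real.arccos_injOn ⟨by linarith, by linarith⟩ ⟨by linarith, by linarith⟩ h
  by_contra hne
  have hlt := lt_of_le_of_ne ha hne
  nlinarith

/-- The ratio y/(x+y) is unchanged by scaling both radii by l and strictly increasing in y. -/
theorem div_add_le_div_add {x y x' y' l : ℝ} (hx : 0 < x) (hy : 0 < y) (hy' : 0 < y') (hl : 0 < l)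
    (hx' : x' = l * x) (hle : y' ≤ l * y) :
    y' / (x' + y') ≤ y / (x + y) ∧ (y' / (x' + y') = y / (x + y) → y' = l * y) := by
  subst hx'
  have : 0 < l * x := mul_pos hl hx
  constructor
  · rw [div_le_div_iff₀ (by linarith) (by linarith)]; nlinarith
  · intro h
    rw [div_eq_div_iff (by linarith) (by linarith)] at h
    have : x * (y' - l * y) = 0 := by linarith
    have := (mul_eq_zero.1 this).resolve_left hx.ne'
    linarith

/-- The distances to 0 and e determine a point up to reflection in the line through them; the sign
of the cross product is the remaining freedom. -/
theorem inner_eq_and_cross_sq_eq {e k l : ℂ} (h₁ : ‖k‖ = ‖l‖) (h₂ : ‖k - e‖ = ‖l - e‖) :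
    inner ℝ e k = inner ℝ e l ∧ cross e k ^ 2 = cross e l ^ 2 := by
  have a := norm_sub_sq_real k e
  have b := norm_sub_sq_real l e
  rw [h₂, h₁] at a
  have hi : inner ℝ e k = inner ℝ e l := by
    rw [real_inner_comm, real_inner_comm l]; linarith
  refine ⟨hi, ?_⟩
  have := cross_sq_add_inner_sq e k
  have := cross_sq_add_inner_sq e l
  rw [hi, h₁] at *
  linarith

/-- The inner and cross products with e are the real and imaginary parts of the conjugate of e times
the point. -/
theorem eq_of_inner_eq_of_cross_eq {e k l : ℂ} (he : e ≠ 0) (h₁ : inner ℝ e k = inner ℝ e l)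
    (h₂ : cross e k = cross e l) : k = l := by
  have h : ∀ k : ℂ, starRingEnd ℂ e * k = ⟨inner ℝ e k, cross e k⟩ := fun k => by
    apply Complex.ext <;> simp [Complex.inner, cross] <;> ring
  have := h k
  rw [h₁, h₂, ← h l] at this
  exact mul_left_cancel₀ ((map_ne_zero _).2 he) this

/-! ### Combinatorics of links and fans -/

namespace BorderedTriangulatedSurface

variable {V : Type*} {S : BorderedTriangulatedSurface V}

theorem eq_of_mem_triangle {t : Finset V} (ht : t ∈ S.triangles) {u v w x : V} (hu : u ∈ t)
    (hv : v ∈ t) (hw : w ∈ t) (hx : x ∈ t) (huv : u ≠ v) (huw : u ≠ w) (hvw : v ≠ w) :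
    x = u ∨ x = v ∨ x = w := by
  classical
  have hsub : ({u, v, w} : Finset V) ⊆ t := by
    intro y hy
    simp only [Finset.mem_insert, Finset.mem_singleton] at hy
    rcases hy with rfl | rfl | rfl <;> assumption
  have hcard : ({u, v, w} : Finset V).card = 3 := Finset.card_eq_three.2
    ⟨u, v, w, huv, huw, hvw, rfl⟩
  have := Finset.eq_of_subset_of_card_le hsub (by rw [hcard, S.card_triangle t ht])
  rw [← this] at hx
  simpa using hx

theorem exists_third_mem {t : Finset V} (ht : t ∈ S.triangles) (u v : V) :
    ∃ w ∈ t, w ≠ u ∧ w ≠ v := by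
  classical
  have h : ({u, v} : Finset V).card < t.card := by
    rw [S.card_triangle t ht]; exact Finset.card_le_two.trans_lt (by norm_num)
  obtain ⟨w, hw, hn⟩ := Finset.exists_mem_notMem_of_card_lt_card h
  simp only [Finset.mem_insert, Finset.mem_singleton, not_or] at hn
  exact ⟨w, hw, hn⟩

theorem link_connected (S : BorderedTriangulatedSurface V) (v : V) :
    (triangleLink S.triangles v).Connected := by
  rcases S.link_cycle_or_path v with ⟨n, ⟨φ⟩⟩ | ⟨n, ⟨φ⟩⟩
  · exact φ.connected_iff.2 SimpleGraph.cycleGraph_connected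
  · exact φ.connected_iff.2 (SimpleGraph.pathGraph_connected _)

theorem exists_triangle_mem (S : BorderedTriangulatedSurface V) (v : V) :
    ∃ t ∈ S.triangles, v ∈ t := by
  obtain ⟨x⟩ := (S.link_connected v).nonempty
  obtain ⟨-, t, ht, hv, -⟩ := x.2
  exact ⟨t, ht, hv⟩

open Fin.NatCast Fin.CommRing in
/-- The neighbours of a vertex whose link is a cycle, in cyclic order. -/
theorem exists_fan {v : V} (h : IsCycleGraph (triangleLink S.triangles v)) :
    ∃ (n : ℕ) (q : ℕ → V) (τ : ℕ → Finset V), 2 ≤ n ∧ q n = q 0 ∧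
      (∀ i, v ≠ q i ∧ q i ≠ q (i + 1) ∧ q i ≠ q (i + 2)) ∧
      (∀ i, τ i ∈ S.triangles ∧ v ∈ τ i ∧ q i ∈ τ i ∧ q (i + 1) ∈ τ i) ∧
      (∀ i < n, ∀ j < n, i ≠ j → τ i ≠ τ j) ∧
      ∀ u, S.skeleton.Adj v u → ∃ i < n, q i = u := by
  obtain ⟨m, ⟨φ⟩⟩ := h
  -- Casting the index to `Fin (m + 3)` makes q periodic, so closing the fan needs no separate case.
  let q : ℕ → V := fun i => φ.symm (i : Fin (m + 3))
  have hinj : ∀ i j, q i = q j → (i : Fin (m + 3)) = (j : Fin (m + 3)) := fun i j hij =>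
    φ.symm.injective (Subtype.ext hij)
  have h1 : (1 : Fin (m + 3)) ≠ 0 := by simp
  have h2 : (2 : Fin (m + 3)) ≠ 0 := by
    rw [Ne, Fin.ext_iff, Fin.val_two]; simp
  have hadj : ∀ i : ℕ, (triangleLink S.triangles v).Adj (φ.symm (i : Fin (m + 3)))
      (φ.symm ((i + 1 : ℕ) : Fin (m + 3))) := by
    intro i
    rw [φ.symm.map_adj_iff, SimpleGraph.cycleGraph_adj]
    right
    push_cast
    ring
  choose hne τ hτ using hadj
  have hq : ∀ i, v ≠ q i ∧ q i ≠ q (i + 1) ∧ q i ≠ q (i + 2) := by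
    refine fun i => ⟨(φ.symm (i : Fin (m + 3))).2.1, fun h => ?_, fun h => ?_⟩
    · have := hinj _ _ h
      push_cast at this
      simp at this
    · have := hinj _ _ h
      push_cast at this
      exact h2 (by simpa using this)
  refine ⟨m + 3, q, τ, by omega, by simp [q], hq, hτ, ?_, ?_⟩
  · intro i hi j hj hij heq
    obtain ⟨hT, hv, ha, hb⟩ := hτ i
    obtain ⟨-, -, ha', hb'⟩ := hτ j
    rw [← heq] at ha' hb'
    have hnat : ∀ i < m + 3, ∀ j < m + 3, (i : Fin (m + 3)) = (j : Fin (m + 3)) → i = j := by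
      intro i hi j hj h
      have := congrArg Fin.val h
      rwa [Fin.val_cast_of_lt hi, Fin.val_cast_of_lt hj] at this
    have A := S.eq_of_mem_triangle hT hv ha hb ha' (hq i).1 (hq (i + 1)).1 (hq i).2.1
    have B := S.eq_of_mem_triangle hT hv ha hb hb' (hq i).1 (hq (i + 1)).1 (hq i).2.1
    rcases A with A | A | A
    · exact (hq j).1 A.symm
    · exact hij (hnat i hi j hj (hinj _ _ A.symm))
    -- The same edge traversed backwards would give 2 = 0 in `Fin (m + 3)`.
    · rcases B with B | B | B
      · exact (hq (j + 1)).1 B.symm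
      · have e₁ := hinj _ _ A
        have e₂ := hinj _ _ B
        push_cast at e₁ e₂
        rw [e₁, add_assoc, one_add_one_eq_two] at e₂
        exact h2 (by simpa using e₂)
      · have e₂ := hinj _ _ B
        push_cast at e₂
        exact hij (hnat i hi j hj (add_right_cancel e₂).symm)
  · intro u hu
    refine ⟨(φ ⟨u, hu⟩ : Fin (m + 3)), (φ ⟨u, hu⟩).2, ?_⟩
    simp [q]

/-! ### Geometry of a realization -/

/-- The circles of centers `c v` and radii `r v` realize the surface in the complex plane. -/
structure IsRealization (S : BorderedTriangulatedSurface V) (c : V → ℂ) (r : V → ℝ) : Prop where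
  radius_pos : ∀ v, 0 < r v
  norm_sub : ∀ u v, S.skeleton.Adj u v → ‖c u - c v‖ = r u + r v
  nonoverlapping : S.triangles.Pairwise fun s t =>
    Disjoint (interior (convexHull ℝ (c '' (s : Set V))))
      (interior (convexHull ℝ (c '' (t : Set V))))

/-- Triangles of centers with a common edge lie on opposite sides of it. -/
def IsFolded (S : BorderedTriangulatedSurface V) (c : V → ℂ) : Prop :=
  ∀ s ∈ S.triangles, ∀ t ∈ S.triangles, ∀ v a b b', v ∈ s → a ∈ s → b ∈ s → v ∈ t → a ∈ t →
    b' ∈ t → v ≠ a → v ≠ b → a ≠ b → v ≠ b' → a ≠ b' → b ≠ b' →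
    cross (c a - c v) (c b - c v) * cross (c a - c v) (c b' - c v) < 0

namespace IsRealization

variable {c c' : V → ℂ} {r r' : V → ℝ}

theorem not_inOpenCone (h : S.IsRealization c r) {s t : Finset V} (hs : s ∈ S.triangles)
    (ht : t ∈ S.triangles) (hst : s ≠ t) {v a b a' b' : V} (hvs : v ∈ s) (ha : a ∈ s) (hb : b ∈ s)
    (hvt : v ∈ t) (ha' : a' ∈ t) (hb' : b' ∈ t) (w : ℂ)
    (h₁ : InOpenCone (c a - c v) (c b - c v) w) (h₂ : InOpenCone (c a' - c v) (c b' - c v) w) :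
    False := by
  refine not_inOpenCone_of_disjoint ((h.nonoverlapping hs ht hst).mono ?_ ?_) w h₁ h₂
  · refine interior_mono (convexHull_mono ?_)
    rintro _ (rfl | rfl | rfl) <;> exact Set.mem_image_of_mem _ (by assumption)
  · refine interior_mono (convexHull_mono ?_)
    rintro _ (rfl | rfl | rfl) <;> exact Set.mem_image_of_mem _ (by assumption)

theorem norm_sub_of_mem (h : S.IsRealization c r) {t : Finset V} (ht : t ∈ S.triangles) {u v : V}
    (hu : u ∈ t) (hv : v ∈ t) (huv : u ≠ v) : ‖c v - c u‖ = r u + r v := by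
  rw [norm_sub_rev]; exact h.norm_sub u v ⟨huv, t, ht, hu, hv⟩

theorem cross_ne_zero (h : S.IsRealization c r) {t : Finset V} (ht : t ∈ S.triangles) {v a b : V}
    (hv : v ∈ t) (ha : a ∈ t) (hb : b ∈ t) (hva : v ≠ a) (hvb : v ≠ b) (hab : a ≠ b) :
    cross (c a - c v) (c b - c v) ≠ 0 := by
  refine cross_ne_zero_of_dist (h.radius_pos v) (h.radius_pos a) (h.radius_pos b)
    (h.norm_sub_of_mem ht hv ha hva) (h.norm_sub_of_mem ht hv hb hvb) ?_
  rw [sub_sub_sub_cancel_right, h.norm_sub_of_mem ht hb ha hab.symm, add_comm]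

theorem angle_eq (h : S.IsRealization c r) {t : Finset V} (ht : t ∈ S.triangles) {v a b : V}
    (hv : v ∈ t) (ha : a ∈ t) (hb : b ∈ t) (hva : v ≠ a) (hvb : v ≠ b) (hab : a ≠ b) :
    InnerProductGeometry.angle (c a - c v) (c b - c v) =
      Real.arccos (1 - 2 * (r a / (r v + r a) * (r b / (r v + r b)))) := by
  refine angle_of_dist (h.radius_pos v) (h.radius_pos a) (h.radius_pos b)
    (h.norm_sub_of_mem ht hv ha hva) (h.norm_sub_of_mem ht hv hb hvb) ?_
  rw [sub_sub_sub_cancel_right, h.norm_sub_of_mem ht hb ha hab.symm, add_comm]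

theorem isFolded (h : S.IsRealization c r) : S.IsFolded c := by
  intro s hs t ht v a b b' hvs has hbs hvt hat hbt hva hvb hab hvb' hab' hbb'
  have hst : s ≠ t := by
    rintro rfl
    rcases S.eq_of_mem_triangle hs hvs has hbs hbt hva hvb hab with e | e | e
    exacts [hvb' e.symm, hab' e.symm, hbb' e.symm]
  exact cross_mul_cross_neg (fun w => h.not_inOpenCone hs ht hst hvs has hbs hvt hat hbt w)
    (h.cross_ne_zero hs hvs has hbs hva hvb hab) (h.cross_ne_zero ht hvt hat hbt hva hvb' hab')

/-- Distinct triangles at v give disjoint cones, and `IsFolded` makes successive triangles of the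
fan turn the same way. Writing the angles through the radii removes the centers, so two packings can
be compared. -/
theorem sum_angle_fan (h : S.IsRealization c r) {v : V} {n : ℕ} {q : ℕ → V} {τ : ℕ → Finset V}
    (hn : 2 ≤ n) (hqn : q n = q 0) (hq : ∀ i, v ≠ q i ∧ q i ≠ q (i + 1) ∧ q i ≠ q (i + 2))
    (hτ : ∀ i, τ i ∈ S.triangles ∧ v ∈ τ i ∧ q i ∈ τ i ∧ q (i + 1) ∈ τ i)
    (hdis : ∀ i < n, ∀ j < n, i ≠ j → τ i ≠ τ j) :
    ∑ i ∈ Finset.range n, Real.arccos (1 - 2 * (r (q i) / (r v + r (q i)) *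
      (r (q (i + 1)) / (r v + r (q (i + 1)))))) = 2 * Real.pi := by
  rw [← sum_angle_eq_two_pi (p := fun i => c (q i) - c v) (n := n) (by omega) (by simp [hqn])]
  · refine Finset.sum_congr rfl fun i _ => ?_
    obtain ⟨h₁, h₂, h₃, h₄⟩ := hτ i
    exact (h.angle_eq h₁ h₂ h₃ h₄ (hq i).1 (hq (i + 1)).1 (hq i).2.1).symm
  · intro i _
    obtain ⟨h₁, h₂, h₃, h₄⟩ := hτ i
    exact h.cross_ne_zero h₁ h₂ h₃ h₄ (hq i).1 (hq (i + 1)).1 (hq i).2.1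
  · intro i _
    obtain ⟨h₁, h₂, h₃, h₄⟩ := hτ i
    obtain ⟨k₁, k₂, k₃, k₄⟩ := hτ (i + 1)
    have := h.isFolded _ h₁ _ k₁ v (q (i + 1)) (q i) (q (i + 2)) h₂ h₄ h₃ k₂ k₃ k₄ (hq (i + 1)).1
      (hq i).1 (hq i).2.1.symm (hq (i + 2)).1 (hq (i + 1)).2.1 (hq i).2.2
    have e : ∀ p q : ℂ, cross p q = -cross q p := fun p q => by unfold cross; ring
    rw [e (c (q (i + 1)) - c v) (c (q i) - c v)] at this
    linarith
  · intro i hi j hj hij w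
    obtain ⟨h₁, h₂, h₃, h₄⟩ := hτ i
    obtain ⟨k₁, k₂, k₃, k₄⟩ := hτ j
    exact h.not_inOpenCone h₁ k₁ (hdis i hi j hj hij) h₂ h₃ h₄ k₂ k₃ k₄ w

/-! ### Maximum principle and uniqueness of the radii -/

/-- Strong maximum principle for the ratio of radii. -/
theorem radius_eq_mul_of_adj (h : S.IsRealization c r) (h' : S.IsRealization c' r') {l : ℝ}
    (hle : ∀ v, r' v ≤ l * r v) {v : V} (hv : r' v = l * r v) (hint : ¬ S.IsBoundaryVertex v)
    {u : V} (hu : S.skeleton.Adj v u) : r' u = l * r u := by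
  obtain ⟨n, q, τ, hn, hqn, hq, hτ, hdis, hall⟩ :=
    exists_fan ((S.link_cycle_or_path v).resolve_right hint)
  have hl : 0 < l := by
    have h₁ := h.radius_pos v
    have h₂ := h'.radius_pos v
    rw [hv] at h₂
    exact (pos_iff_pos_of_mul_pos h₂).2 h₁
  have hr : ∀ u, 0 < r' u / (r' v + r' u) ∧ r u / (r v + r u) < 1 := fun u => by
    have h₁ := h.radius_pos v
    have h₂ := h'.radius_pos v
    have h₃ := h.radius_pos u
    have h₄ := h'.radius_pos u
    exact ⟨by positivity, by rw [div_lt_one (by positivity)]; linarith⟩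
  have hd := fun u => div_add_le_div_add (h.radius_pos v) (h.radius_pos u) (h'.radius_pos u) hl hv
    (hle u)
  have hcmp := fun i => arccos_le_of_ratio_le (hr (q i)).1 (hr (q (i + 1))).1 (hd (q i)).1
    (hd (q (i + 1))).1 (hr (q i)).2 (hr (q (i + 1))).2
  have hsum := (h'.sum_angle_fan hn hqn hq hτ hdis).trans (h.sum_angle_fan hn hqn hq hτ hdis).symm
  -- Termwise comparable angles with equal sums are equal term by term.
  have heq := (Finset.sum_eq_sum_iff_of_le fun i _ => (hcmp i).1).1 hsum
  obtain ⟨i, hi, rfl⟩ := hall u hu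
  exact (hd (q i)).2 ((hcmp i).2 (heq i (Finset.mem_range.2 hi)))

/-- A maximal ratio above 1 cannot occur on the boundary, yet it propagates along any path of the
1-skeleton, and some vertex is a boundary vertex. -/
theorem radius_le [Finite V] (h : S.IsRealization c r) (h' : S.IsRealization c' r')
    (hb : ∀ v, S.IsBoundaryVertex v → r' v = r v) (v : V) : r' v ≤ r v := by
  obtain ⟨b, hbd⟩ := S.bordered
  have : Nonempty V := ⟨b⟩
  obtain ⟨m, hm⟩ := Finite.exists_max fun v => r' v / r v
  set l := r' m / r m with hl
  have hle : ∀ v, r' v ≤ l * r v := fun v => (div_le_iff₀ (h.radius_pos v)).1 (hm v)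
  by_contra! hlt
  have hl1 : 1 < l := lt_of_lt_of_le ((one_lt_div (h.radius_pos v)).2 hlt) (hm v)
  have hmem : r' m = l * r m := by
    have := (h.radius_pos m).ne'
    rw [hl]; field_simp
  have hnb : ∀ u, r' u = l * r u → ¬ S.IsBoundaryVertex u := fun u hu hub => by
    have := hb u hub
    have := h.radius_pos u
    nlinarith
  have hall : ∀ u w, S.skeleton.Reachable u w → r' u = l * r u → r' w = l * r w := by
    rintro u w ⟨p⟩
    induction p with
    | nil => exact id
    | cons hadj _ ih =>
      exact fun hu => ih (h.radius_eq_mul_of_adj h' hle hu (hnb _ hu) hadj)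
  exact hnb b (hall m b (S.connected.preconnected m b) hmem) hbd

end IsRealization

/-! ### Rigidity of the centers -/

/-- The third vertex of t is fixed up to reflection in the common edge, and foldedness places it
opposite the third vertex of s in both layouts. Only edge lengths and foldedness are asked of c,
since these pass easily through an isometry. -/
theorem eq_on_triangle {c c' : V → ℂ} {r : V → ℝ} (hc : ∀ u v, S.skeleton.Adj u v →
    ‖c u - c v‖ = r u + r v) (hc' : S.IsRealization c' r) (hf : S.IsFolded c) {s t : Finset V}
    (hs : s ∈ S.triangles) (ht : t ∈ S.triangles) {v a : V} (hva : v ≠ a) (hvs : v ∈ s)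
    (has : a ∈ s) (hvt : v ∈ t) (hat : a ∈ t) (heq : ∀ x ∈ s, c x = c' x) :
    ∀ x ∈ t, c x = c' x := by
  intro x hx
  obtain ⟨b, hb, hbv, hba⟩ := S.exists_third_mem hs v a
  rcases eq_or_ne x v with rfl | hxv
  · exact heq x hvs
  rcases eq_or_ne x a with rfl | hxa
  · exact heq x has
  rcases eq_or_ne b x with rfl | hbx
  · exact heq b hb
  have f₁ := hf s hs t ht v a b x hvs has hb hvt hat hx hva hbv.symm hba.symm hxv.symm hxa.symm hbx
  have f₂ := hc'.isFolded s hs t ht v a b x hvs has hb hvt hat hx hva hbv.symm hba.symm hxv.symm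
    hxa.symm hbx
  rw [heq v hvs, heq a has, heq b hb] at f₁
  have n₁ : ‖c x - c' v‖ = ‖c' x - c' v‖ := by
    rw [← heq v hvs, hc x v ⟨hxv, t, ht, hx, hvt⟩, heq v hvs,
      hc'.norm_sub x v ⟨hxv, t, ht, hx, hvt⟩]
  have n₂ : ‖(c x - c' v) - (c' a - c' v)‖ = ‖(c' x - c' v) - (c' a - c' v)‖ := by
    rw [sub_sub_sub_cancel_right, sub_sub_sub_cancel_right, ← heq a has,
      hc x a ⟨hxa, t, ht, hx, hat⟩, heq a has, hc'.norm_sub x a ⟨hxa, t, ht, hx, hat⟩]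
  obtain ⟨hi, hsq⟩ := inner_eq_and_cross_sq_eq n₁ n₂
  have hne : c' a - c' v ≠ 0 := by
    intro h0; rw [h0] at f₂; simp [cross] at f₂
  have hcr : cross (c' a - c' v) (c x - c' v) = cross (c' a - c' v) (c' x - c' v) := by
    rcases sq_eq_sq_iff_eq_or_eq_neg.1 hsq with h | h
    · exact h
    · rw [h] at f₁
      linarith
  exact sub_left_inj.1 (eq_of_inner_eq_of_cross_eq hne hi hcr)

theorem eq_of_eq_on_triangle {c c' : V → ℂ} {r : V → ℝ} (hc : ∀ u v, S.skeleton.Adj u v →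
    ‖c u - c v‖ = r u + r v) (hc' : S.IsRealization c' r) (hf : S.IsFolded c) {s : Finset V}
    (hs : s ∈ S.triangles) (heq : ∀ x ∈ s, c x = c' x) (v : V) : c v = c' v := by
  -- Agreement spreads around a vertex because its link is connected: triangles adjacent in the link
  -- share an edge, so there is no hinge at v.
  have star : ∀ v, ∀ s ∈ S.triangles, v ∈ s → (∀ x ∈ s, c x = c' x) →
      ∀ t ∈ S.triangles, v ∈ t → ∀ x ∈ t, c x = c' x := by
    intro v s hs hvs hsx t ht hvt
    obtain ⟨a, has, hav, -⟩ := S.exists_third_mem hs v v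
    obtain ⟨b, hbt, hbv, -⟩ := S.exists_third_mem ht v v
    have hA : (triangleSkeleton S.triangles).Adj v a := ⟨hav.symm, s, hs, hvs, has⟩
    have hB : (triangleSkeleton S.triangles).Adj v b := ⟨hbv.symm, t, ht, hvt, hbt⟩
    have key : ∀ x y : (triangleSkeleton S.triangles).neighborSet v,
        (triangleLink S.triangles v).Reachable x y →
        (∃ t ∈ S.triangles, v ∈ t ∧ (x : V) ∈ t ∧ ∀ z ∈ t, c z = c' z) →
        ∃ t ∈ S.triangles, v ∈ t ∧ (y : V) ∈ t ∧ ∀ z ∈ t, c z = c' z := by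
      rintro x y ⟨p⟩
      induction p with
      | nil => exact id
      | @cons x y z hadj p ih =>
        rintro ⟨t₁, ht₁, hv₁, hx₁, hz₁⟩
        obtain ⟨-, t₂, ht₂, hv₂, hx₂, hy₂⟩ := hadj
        exact ih ⟨t₂, ht₂, hv₂, hy₂, eq_on_triangle hc hc' hf ht₁ ht₂ x.2.1 hv₁ hx₁ hv₂ hx₂ hz₁⟩
    obtain ⟨t₁, ht₁, hv₁, hb₁, hz₁⟩ := key ⟨a, hA⟩ ⟨b, hB⟩ ((S.link_connected v).preconnected _ _)
      ⟨s, hs, hvs, has, hsx⟩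
    exact eq_on_triangle hc hc' hf ht₁ ht hbv.symm hv₁ hb₁ hvt hbt hz₁
  have key : ∀ x y, S.skeleton.Reachable x y →
      (∃ t ∈ S.triangles, x ∈ t ∧ ∀ z ∈ t, c z = c' z) →
      ∃ t ∈ S.triangles, y ∈ t ∧ ∀ z ∈ t, c z = c' z := by
    rintro x y ⟨p⟩
    induction p with
    | nil => exact id
    | @cons x y z hadj p ih =>
      rintro ⟨t₁, ht₁, hx₁, hz₁⟩
      obtain ⟨-, t₂, ht₂, hx₂, hy₂⟩ := hadj
      exact ih ⟨t₂, ht₂, hy₂, star x t₁ ht₁ hx₁ hz₁ t₂ ht₂ hx₂⟩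
  obtain ⟨a, has, -⟩ := S.exists_third_mem hs v v
  obtain ⟨t, -, hvt, h⟩ := key a v (S.connected.preconnected a v) ⟨s, hs, has, heq⟩
  exact h v hvt

/-- One triangle is matched by a translation and a rotation, preceded by complex conjugation when
the two orientations differ; the rest follows by propagation. -/
theorem exists_isometry {c c' : V → ℂ} {r : V → ℝ} (h : S.IsRealization c r)
    (h' : S.IsRealization c' r) : ∃ g : ℂ ≃ᵢ ℂ, ∀ v, g (c v) = c' v := by
  obtain ⟨u, -⟩ := S.bordered
  obtain ⟨t, ht, hu⟩ := S.exists_triangle_mem u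
  obtain ⟨v, hv, hvu, -⟩ := S.exists_third_mem ht u u
  obtain ⟨w, hw, hwu, hwv⟩ := S.exists_third_mem ht u v
  -- σ is the determinant of ψ. Foldedness concerns a product of two cross products, so it only sees
  -- σ² = 1.
  have main : ∀ (ψ : ℂ ≃ₗᵢ[ℝ] ℂ) (σ : ℝ), σ ^ 2 = 1 →
      (∀ p q, cross (ψ p) (ψ q) = σ * cross p q) → ψ (c v - c u) = c' v - c' u →
      σ * cross (c v - c u) (c w - c u) = cross (c' v - c' u) (c' w - c' u) →
      ∃ g : ℂ ≃ᵢ ℂ, ∀ v, g (c v) = c' v := by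
    intro ψ σ hσ hcr hψ hψw
    rw [← hcr, hψ] at hψw
    let g : ℂ ≃ᵢ ℂ := ((IsometryEquiv.subRight (c u)).trans ψ.toIsometryEquiv).trans
      (IsometryEquiv.addRight (c' u))
    have hg : ∀ z, g z = ψ (z - c u) + c' u := fun z => rfl
    have hgs : ∀ y z, g y - g z = ψ (y - z) := fun y z => by
      rw [hg, hg, add_sub_add_right_eq_sub, ← map_sub, sub_sub_sub_cancel_right]
    refine ⟨g, eq_of_eq_on_triangle (c := fun v => g (c v)) (r := r) ?_ h' ?_ ht ?_⟩
    · intro x y hxy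
      rw [hgs, ψ.norm_map, h.norm_sub x y hxy]
    · intro s hs t ht v a b b' h₁ h₂ h₃ h₄ h₅ h₆ h₇ h₈ h₉ k₁ k₂ k₃
      have := h.isFolded s hs t ht v a b b' h₁ h₂ h₃ h₄ h₅ h₆ h₇ h₈ h₉ k₁ k₂ k₃
      rw [hgs, hgs, hgs, hcr, hcr]
      nlinarith
    · have hgu : g (c u) = c' u := by simp [hg]
      have hgv : g (c v) = c' v := by rw [hg, hψ, sub_add_cancel]
      have hgw : g (c w) = c' w := by
        have e : ψ (c w - c u) = c' w - c' u := by
          have n₁ : ‖ψ (c w - c u)‖ = ‖c' w - c' u‖ := by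
            rw [ψ.norm_map, h.norm_sub_of_mem ht hu hw hwu.symm,
              h'.norm_sub_of_mem ht hu hw hwu.symm]
          have n₂ : ‖ψ (c w - c u) - (c' v - c' u)‖ = ‖(c' w - c' u) - (c' v - c' u)‖ := by
            rw [← hψ, ← map_sub, ψ.norm_map, hψ, sub_sub_sub_cancel_right,
              sub_sub_sub_cancel_right, h.norm_sub_of_mem ht hv hw hwv.symm,
              h'.norm_sub_of_mem ht hv hw hwv.symm]
          have hne : c' v - c' u ≠ 0 := by
            intro h0
            apply h'.cross_ne_zero ht hu hv hw hvu.symm hwu.symm hwv.symm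
            simp [h0, cross]
          exact eq_of_inner_eq_of_cross_eq hne (inner_eq_and_cross_sq_eq n₁ n₂).1 hψw
        rw [hg, e, sub_add_cancel]
      intro x hx
      rcases S.eq_of_mem_triangle ht hu hv hw hx hvu.symm hwu.symm hwv.symm with rfl | rfl | rfl
      exacts [hgu, hgv, hgw]
  have hnv : ‖c' v - c' u‖ = ‖c v - c u‖ := by
    rw [h.norm_sub_of_mem ht hu hv hvu.symm, h'.norm_sub_of_mem ht hu hv hvu.symm]
  have hne : c v - c u ≠ 0 := by
    intro h0
    apply h.cross_ne_zero ht hu hv hw hvu.symm hwu.symm hwv.symm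
    simp [h0, cross]
  have hne' : c' v - c' u ≠ 0 := by
    rw [← norm_ne_zero_iff, hnv]; exact norm_ne_zero_iff.2 hne
  -- Equal side lengths give equal areas up to sign; the sign decides between a rotation and a
  -- reflection.
  have hsq : cross (c v - c u) (c w - c u) ^ 2 = cross (c' v - c' u) (c' w - c' u) ^ 2 := by
    have i := inner_of_dist (h.norm_sub_of_mem ht hu hv hvu.symm)
      (h.norm_sub_of_mem ht hu hw hwu.symm) (by
        rw [sub_sub_sub_cancel_right, h.norm_sub_of_mem ht hw hv hwv, add_comm])
    have i' := inner_of_dist (h'.norm_sub_of_mem ht hu hv hvu.symm)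
      (h'.norm_sub_of_mem ht hu hw hwu.symm) (by
        rw [sub_sub_sub_cancel_right, h'.norm_sub_of_mem ht hw hv hwv, add_comm])
    have k := cross_sq_add_inner_sq (c v - c u) (c w - c u)
    have k' := cross_sq_add_inner_sq (c' v - c' u) (c' w - c' u)
    rw [i, h.norm_sub_of_mem ht hu hw hwu.symm, ← hnv] at k
    rw [i', h'.norm_sub_of_mem ht hu hw hwu.symm] at k'
    linarith
  have hrot : ∀ (a : Circle) (p q : ℂ), cross (a * p) (a * q) = cross p q := fun a p q => by
    have : cross (a * p) (a * q) = normSq a * cross p q := by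
      simp only [cross, mul_re, mul_im, normSq_apply]; ring
    rw [this, Circle.normSq_coe, one_mul]
  have hrotation : ∀ d : ℂ, ‖d‖ = ‖c' v - c' u‖ → ∃ a : Circle, a * d = c' v - c' u := by
    intro d hd
    have hd0 : d ≠ 0 := by rw [← norm_ne_zero_iff, hd]; exact norm_ne_zero_iff.2 hne'
    exact ⟨⟨(c' v - c' u) / d, mem_sphere_zero_iff_norm.2 (by
      rw [norm_div, hd, div_self (norm_ne_zero_iff.2 hne')])⟩, div_mul_cancel₀ _ hd0⟩
  rcases sq_eq_sq_iff_eq_or_eq_neg.1 hsq with hs | hs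
  · obtain ⟨a, ha⟩ := hrotation (c v - c u) hnv.symm
    refine main (rotation a) 1 (by norm_num) (fun p q => ?_) ?_ (by rw [hs, one_mul])
    · rw [rotation_apply, rotation_apply, hrot, one_mul]
    · rw [rotation_apply, ha]
  · obtain ⟨a, ha⟩ := hrotation (conjLIE (c v - c u)) (by rw [conjLIE.norm_map, hnv])
    refine main (conjLIE.trans (rotation a)) (-1) (by norm_num) (fun p q => ?_) ?_
      (by rw [hs]; ring)
    · rw [LinearIsometryEquiv.trans_apply, LinearIsometryEquiv.trans_apply, rotation_apply,
        rotation_apply, hrot, conjLIE_apply, conjLIE_apply, cross_conj, neg_one_mul]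
    · rw [LinearIsometryEquiv.trans_apply, rotation_apply, ha]

end BorderedTriangulatedSurface

/-! ### Transfer to the Euclidean plane -/

open BorderedTriangulatedSurface

/-- The linear isometry between the Euclidean plane and the complex plane. -/
noncomputable def planeToComplex : Plane ≃ₗᵢ[ℝ] ℂ := Complex.orthonormalBasisOneI.repr.symm

theorem PlanarCirclePacking.TriangleType.isRealization {V ι : Type*}
    {S : BorderedTriangulatedSurface V} {P : PlanarCirclePacking ι} (e : P.TriangleType S) :
    S.IsRealization (fun v => planeToComplex (P.center (e.iso.symm v)))
      (fun v => P.radius (e.iso.symm v)) where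
  radius_pos v := P.radius_pos _
  norm_sub u v huv := by
    rw [← map_sub, LinearIsometryEquiv.norm_map, ← dist_eq_norm]
    exact (e.iso.symm.map_adj_iff.2 huv).2
  nonoverlapping s hs t ht hst := by
    -- A linear isometry commutes with convex hulls, being linear, and with interiors, being a
    -- homeomorphism.
    have key : ∀ s : Finset V, interior (convexHull ℝ
        ((fun v => planeToComplex (P.center (e.iso.symm v))) '' (s : Set V))) =
        planeToComplex '' interior (convexHull ℝ
          ((fun v => P.center (e.iso.symm v)) '' (s : Set V))) := by
      intro s
      have h₁ := planeToComplex.toHomeomorph.image_interior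
        (convexHull ℝ ((fun v => P.center (e.iso.symm v)) '' (s : Set V)))
      have h₂ := planeToComplex.toLinearEquiv.toLinearMap.image_convexHull
        ((fun v => P.center (e.iso.symm v)) '' (s : Set V))
      rw [Set.image_image] at h₂
      exact (h₁.trans (congrArg interior h₂)).symm
    beta_reduce
    rw [key, key]
    exact Set.disjoint_image_of_injective planeToComplex.injective (e.nonoverlapping hs ht hst)

theorem mainTheorem5 {V ι κ : Type*} [Finite V] (S : BorderedTriangulatedSurface V)
    (P : PlanarCirclePacking ι) (Q : PlanarCirclePacking κ)
    (e : P.TriangleType S) (f : Q.TriangleType S)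
    (hbdry : ∀ v, S.IsBoundaryVertex v → P.radius (e.iso.symm v) = Q.radius (f.iso.symm v)) :
    (∀ v, P.radius (e.iso.symm v) = Q.radius (f.iso.symm v)) ∧
      ∃ g : Plane ≃ᵢ Plane, ∀ v, g '' P.circle (e.iso.symm v) = Q.circle (f.iso.symm v) := by
  have hP := e.isRealization
  have hQ := f.isRealization
  have hr : ∀ v, P.radius (e.iso.symm v) = Q.radius (f.iso.symm v) := fun v =>
    le_antisymm (hQ.radius_le hP hbdry v) (hP.radius_le hQ (fun v hv => (hbdry v hv).symm) v)
  refine ⟨hr, ?_⟩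
  -- Both realizations now have the same radius function, as `exists_isometry` requires.
  rw [← funext hr] at hQ
  obtain ⟨g, hg⟩ := exists_isometry hP hQ
  refine ⟨(planeToComplex.toIsometryEquiv.trans g).trans planeToComplex.symm.toIsometryEquiv,
    fun v => ?_⟩
  rw [PlanarCirclePacking.circle, PlanarCirclePacking.circle, IsometryEquiv.image_sphere, hr]
  congr 1
  have := hg v
  simp only [IsometryEquiv.trans_apply, LinearIsometryEquiv.coe_toIsometryEquiv]
  rw [this, LinearIsometryEquiv.symm_apply_apply]
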